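/- **Definitions.** Let $M=(M_k)_{k\in\mathbb N}$, $\mathbb N=\{0,1,2,\dots\}$, be a sequence of positive real numbers. For $U\subseteq\mathbb R^n$ open, $C^M(U)$ is the set of all $f\in C^\infty(U,\mathbb R)$ such that for every compact $K\subseteq U$ there are $C,\rho>0$ with $|\partial^\alpha f(x)|\le C\,\rho^{|\alpha|}\,|\alpha|!\,M_{|\alpha|}$ for all $\alpha\in\mathbb N^n$ and $x\in K$. The sequence $M$ is *quasianalytic* if for all $n$, all connected open $U\subseteq\mathbb R^n$ and all $a\in U$, each function in $C^M(U)$ is determined by its Taylor series at $a$. It is *log-convex* if $M_k^2\le M_{k-1}M_{k+1}$ for all $k\ge1$, *weakly log-convex* if $(k!\,M_k)_k$ is log-convex, and a *weight sequence* if it is log-convex and $M_0=1\le M_1$. Put $$\mathcal F^M=\{(f_k)_k\in\mathbb R^{\mathbb N}:\ \exists\,\rho>0\ \exists\,C>0\ \forall k\in\mathbb N:\ |f_k|\le C\,\rho^k\,k!\,M_k\},$$ $$\mathcal L_w(M)=\{L:\ L\text{ a non-quasianalytic, weakly log-convex sequence of positive reals},\ L_k\ge M_k\text{ for all }k\}.$$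 **Corollary 1.7 and its real-analytic case.** 1. For every quasianalytic weight sequence $Q$, $$\mathcal F^Q=\bigcap_{L\in\mathcal L_w(Q)}\mathcal F^L .$$ 2. In particular, the constant sequence $\omega=(1)_k$, which describes the real-analytic class, is a quasianalytic weight sequence and $\mathcal F^\omega=\bigcap_{L\in\mathcal L_w(\omega)}\mathcal F^L$. 3. This strengthens Bang's theorem: let $\mathcal B$ be the set of all non-quasianalytic sequences $L$ of positive reals such that $(k!\,L_k)^{1/k}$ is increasing (in the weak sense) in $k\ge1$. For every $L\in\mathcal L_w(\omega)$, the sequence $(L_k/L_0)_k$ lies in $\mathcal B$ and $\mathcal F^{(L_k/L_0)_k}=\mathcal F^L$; and (Bang) $\mathcal F^\omega=\bigcap_{L\in\mathcal B}\mathcal F^L$. -/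

import Mathlib

open scoped Nat ContDiff

noncomputable section

namespace DenjoyCarleman

/-- The partial derivative `∂^α f` at `x` for a multi-index `α ∈ ℕⁿ`: the derivative of order
`|α| = α₁ + ⋯ + αₙ` of `f` at `x`, evaluated at the list of standard basis vectors in which `e₁`
occurs `α₁` times, then `e₂` occurs `α₂` times, and so on. -/
def partialDeriv {n : ℕ} (α : Fin n → ℕ) (f : EuclideanSpace ℝ (Fin n) → ℝ)
    (x : EuclideanSpace ℝ (Fin n)) : ℝ :=
  iteratedFDeriv ℝ (∑ i, α i) f x
    (fun j => EuclideanSpace.single (finSigmaFinEquiv.symm j).1 (1 : ℝ))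

/-- `f` belongs to the Denjoy--Carleman class `C^M(U)`. It is used for open `U` only, and a function
on `U` is represented by any extension of it to the whole space. -/
def IsDenjoyCarleman (M : ℕ → ℝ) {n : ℕ} (U : Set (EuclideanSpace ℝ (Fin n)))
    (f : EuclideanSpace ℝ (Fin n) → ℝ) : Prop :=
  ContDiffOn ℝ ∞ f U ∧
    ∀ K : Set (EuclideanSpace ℝ (Fin n)), IsCompact K → K ⊆ U →
      ∃ C > (0 : ℝ), ∃ ρ > (0 : ℝ), ∀ α : Fin n → ℕ, ∀ x ∈ K,
        |partialDeriv α f x| ≤ C * ρ ^ (∑ i, α i) * ((∑ i, α i)! : ℝ) * M (∑ i, α i)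

/-- `C^M` is quasianalytic: for every `n`, every connected open `U ⊆ ℝⁿ` and every `a ∈ U`, a
function in `C^M(U)` is determined on `U` by its Taylor series at `a`. -/
def IsQuasianalytic (M : ℕ → ℝ) : Prop :=
  ∀ (n : ℕ) (U : Set (EuclideanSpace ℝ (Fin n))), IsOpen U → IsConnected U → ∀ a ∈ U,
    ∀ f g : EuclideanSpace ℝ (Fin n) → ℝ, IsDenjoyCarleman M U f → IsDenjoyCarleman M U g →
      (∀ α : Fin n → ℕ, partialDeriv α f a = partialDeriv α g a) → Set.EqOn f g U

/-- Log-convexity of a sequence of positive numbers. -/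
def IsLogConvex (M : ℕ → ℝ) : Prop :=
  ∀ k : ℕ, M (k + 1) ^ 2 ≤ M k * M (k + 2)

/-- `M` is weakly log-convex: `k ↦ k! M_k` is log-convex. -/
def IsWeaklyLogConvex (M : ℕ → ℝ) : Prop :=
  IsLogConvex (fun k => (k ! : ℝ) * M k)

/-- Weight sequences: log-convex sequences of positive reals with `M_0 = 1 ≤ M_1`. -/
structure IsWeightSequence (M : ℕ → ℝ) : Prop where
  pos : ∀ k, 0 < M k
  zero_eq_one : M 0 = 1
  one_le_one : 1 ≤ M 1
  logConvex : IsLogConvex M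

/-- The sequence space `F^M_ρ`. -/
def seqSpaceRho (M : ℕ → ℝ) (ρ : ℝ) : Set (ℕ → ℝ) :=
  {f | ∃ C > (0 : ℝ), ∀ k : ℕ, |f k| ≤ C * ρ ^ k * (k ! : ℝ) * M k}

/-- The sequence space `F^M`, the union of all `F^M_ρ` with `ρ > 0`. -/
def seqSpace (M : ℕ → ℝ) : Set (ℕ → ℝ) :=
  ⋃ ρ ∈ Set.Ioi (0 : ℝ), seqSpaceRho M ρ

/-- `L_w(M)`: the non-quasianalytic, weakly log-convex sequences `L ≥ M` of positive reals. -/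
def weakMajorants (M : ℕ → ℝ) : Set (ℕ → ℝ) :=
  {L | (∀ k, 0 < L k) ∧ (∀ k, M k ≤ L k) ∧ ¬ IsQuasianalytic L ∧ IsWeaklyLogConvex L}

/-- The family in Bang's theorem: the non-quasianalytic sequences `L` of positive reals for which
`(k! L_k)^{1/k}`, `k ≥ 1`, is increasing. -/
def bangFamily : Set (ℕ → ℝ) :=
  {L | (∀ k, 0 < L k) ∧ ¬ IsQuasianalytic L ∧
    MonotoneOn (fun k : ℕ => ((k ! : ℝ) * L k) ^ ((1 : ℝ) / (k : ℝ))) (Set.Ici 1)}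

/-- The weight sequence `ω = (1)_k` of the real-analytic class. -/
def omega : ℕ → ℝ := fun _ => 1

end DenjoyCarleman

end

/-!
The inclusion `F^Q ⊆ F^L` is immediate from `Q ≤ L`. For the converse, let `f ∉ F^Q`. Then for every
`j` the bound `|f_k| > 4^(jk) k! Q_k` holds for infinitely many `k`, and a strictly increasing
sequence `κ` can be chosen for which it holds at `k = κ_j`. The quotients `k Q_k / Q_(k-1)` of
`k! Q_k` are replaced by `c_k Q_k / Q_(k-1)`, where `c_k ≥ k` is increasing, constant between
consecutive `κ_j`, at most `2^(j+1) κ_j` for `k ≤ κ_j`, and has summable reciprocals. These are the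
quotients of `k! L_k` for a sequence `L ≥ Q` (`stretchedMajorant`), which is weakly log-convex
because `Q_k / Q_(k-1)` is increasing by log-convexity of `Q`, and non-quasianalytic because
`Q_k / Q_(k-1) ≥ 1`. By `k^k ≤ e^k k!`, putting `κ_j` in place of `k` costs only a geometric factor,
so that `κ_j! L_(κ_j) ≤ (2^(j+1) e)^(κ_j) κ_j! Q_(κ_j)`; this keeps `f` out of `F^L`.

That such an `L` is not quasianalytic (`not_isQuasianalytic_of_summable`) is the elementary half of
the Denjoy--Carleman theorem. If `∑ 1 / ℓ_k < ∞`, averaging a ramp successively over intervals of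
the lengths `1 / ℓ_k` converges uniformly to a smooth function that vanishes on `x ≤ 0`, is not
zero, and has `k`-th derivative at most `T 2^k ℓ_0 ⋯ ℓ_(k-1)`. The derivatives are controlled
through a family `u_m` with `u_m` the average of `u_(m+1)` over length `1 / ℓ_m`: differentiating
`u_m` once yields a difference quotient of `u_(m+1)`.

In the other direction, `L` is quasianalytic as soon as `L_k ≤ R^k` for infinitely many `k`
(`isQuasianalytic_of_frequently_le`): Taylor's formula at those orders shows that a function flat at
a point vanishes near it, and a connectedness argument finishes. Thus `ω` is quasianalytic, and a
non-quasianalytic `L` has `L_k ≥ 1` eventually, so `F^ω ⊆ F^L` for all members of Bang's family. The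
reverse inclusion holds because `L / L_0` lies in that family for each weak majorant `L` of `ω`, by
monotonicity of `m_k^(1/k)` for log-convex `m` with `m_0 = 1`.
-/

noncomputable section

namespace DenjoyCarleman

open Filter Topology
open scoped BoundedContinuousFunction

/-! ### Symmetry of higher derivatives -/

/-- The iterated directional derivative of `f` along the vectors of a list, the last vector of the
list being differentiated first. Lists make invariance under permutations an induction on
`List.Perm`, whose `swap` case is the symmetry of the second derivative. -/
def listLineDeriv {E : Type*} [NormedAddCommGroup E] [NormedSpace ℝ E] (f : E → ℝ) :
    List E → E → ℝ
  | [] => f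
  | v :: l => fun x => fderiv ℝ (listLineDeriv f l) x v

section Symmetry

variable {E : Type*} [NormedAddCommGroup E] [NormedSpace ℝ E] {f : E → ℝ} {U : Set E}

theorem contDiffOn_listLineDeriv (hU : IsOpen U) (hf : ContDiffOn ℝ ∞ f U) (l : List E) :
    ContDiffOn ℝ ∞ (listLineDeriv f l) U := by
  induction l with
  | nil => exact hf
  | cons v l ih => exact (ih.fderiv_of_isOpen hU (by simp)).clm_apply contDiffOn_const

theorem listLineDeriv_eqOn_of_perm (hU : IsOpen U) (hf : ContDiffOn ℝ ∞ f U) {l l' : List E}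
    (hl : l.Perm l') : Set.EqOn (listLineDeriv f l) (listLineDeriv f l') U := by
  induction hl with
  | nil => exact fun _ _ => rfl
  | cons v _ ih =>
    intro x hx
    exact congrArg (fun T : E →L[ℝ] ℝ => T v) (ih.eventuallyEq_of_mem (hU.mem_nhds hx)).fderiv_eq
  | swap v w l =>
    intro x hx
    have hg := (contDiffOn_listLineDeriv hU hf l).contDiffAt (hU.mem_nhds hx)
    have h2 : (2 : WithTop ℕ∞) ≤ ∞ := WithTop.coe_le_coe.mpr (le_top : (2 : ℕ∞) ≤ ⊤)
    have hd : DifferentiableAt ℝ (fderiv ℝ (listLineDeriv f l)) x :=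
      (hg.fderiv_right (m := 1) (by rwa [one_add_one_eq_two])).differentiableAt one_ne_zero
    have hs := (hg.isSymmSndFDerivAt (by rwa [minSmoothness_of_isRCLikeNormedField])).eq w v
    simp only [listLineDeriv]
    rw [fderiv_clm_apply hd (differentiableAt_const _),
      fderiv_clm_apply hd (differentiableAt_const _)]
    simpa using hs
  | trans _ _ ih₁ ih₂ => exact ih₁.trans ih₂

theorem iteratedFDeriv_eq_listLineDeriv (hU : IsOpen U) (hf : ContDiffOn ℝ ∞ f U) {k : ℕ}
    (v : Fin k → E) : Set.EqOn (fun x => iteratedFDeriv ℝ k f x v)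
      (listLineDeriv f (List.ofFn v)) U := by
  induction k with
  | zero => intro x _; simp [listLineDeriv]
  | succ k ih =>
    intro x hx
    have hd : DifferentiableAt ℝ (iteratedFDeriv ℝ k f) x :=
      (hf.contDiffAt (hU.mem_nhds hx)).differentiableAt_iteratedFDeriv
        (by exact_mod_cast ENat.natCast_lt_top k)
    simp only [List.ofFn_succ, listLineDeriv]
    rw [hd.iteratedFDeriv_succ_apply_left']
    exact congrArg (fun T : E →L[ℝ] ℝ => T (v 0))
      ((ih (Fin.tail v)).eventuallyEq_of_mem (hU.mem_nhds hx)).fderiv_eq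

/-- The derivatives of a smooth function are symmetric. `ContDiffAt.iteratedFDeriv_comp_perm` gives
this for analytic functions only. -/
theorem iteratedFDeriv_comp_perm (hU : IsOpen U) (hf : ContDiffOn ℝ ∞ f U) {x : E} (hx : x ∈ U)
    {k : ℕ} (v : Fin k → E) (σ : Equiv.Perm (Fin k)) :
    iteratedFDeriv ℝ k f x (v ∘ σ) = iteratedFDeriv ℝ k f x v :=
  ((iteratedFDeriv_eq_listLineDeriv hU hf _ hx).trans
    (listLineDeriv_eqOn_of_perm hU hf (σ.ofFn_comp_perm v) hx)).trans
    (iteratedFDeriv_eq_listLineDeriv hU hf _ hx).symm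

end Symmetry

/-! ### Partial derivatives bound the full derivative -/

/-- A derivative along basis vectors in any order is a partial derivative `∂^α f`: sort the
vectors, `α i` being the number of occurrences of the `i`-th one. -/
theorem exists_partialDeriv_eq {n : ℕ} {f : EuclideanSpace ℝ (Fin n) → ℝ}
    {U : Set (EuclideanSpace ℝ (Fin n))} (hU : IsOpen U) (hf : ContDiffOn ℝ ∞ f U)
    {x : EuclideanSpace ℝ (Fin n)} (hx : x ∈ U) {k : ℕ} (r : Fin k → Fin n) :
    ∃ α : Fin n → ℕ, ∑ i, α i = k ∧
      iteratedFDeriv ℝ k f x (fun j => EuclideanSpace.single (r j) (1 : ℝ)) =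
        partialDeriv α f x := by
  have key : ∀ (m : ℕ) (σ : Fin m ≃ Fin k), m = k →
      iteratedFDeriv ℝ k f x (fun j => EuclideanSpace.single (r j) (1 : ℝ)) =
        iteratedFDeriv ℝ m f x (fun j => EuclideanSpace.single (r (σ j)) (1 : ℝ)) := by
    rintro m σ rfl
    exact (iteratedFDeriv_comp_perm hU hf hx
      (fun j => EuclideanSpace.single (r j) (1 : ℝ)) σ).symm
  let α : Fin n → ℕ := fun i => Fintype.card {j // r j = i}
  -- `τ` lists the positions `j` grouped by the value `r j`.
  let τ : (Σ i, Fin (α i)) ≃ Fin k :=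
    (Equiv.sigmaCongrRight fun i => (Fintype.equivFin {j // r j = i}).symm).trans
      (Equiv.sigmaFiberEquiv r)
  have hτ : ∀ p, r (τ p) = p.1 := fun p =>
    ((Fintype.equivFin {j // r j = p.1}).symm p.2).2
  let σ : Fin (∑ i, α i) ≃ Fin k := finSigmaFinEquiv.symm.trans τ
  have hα : ∑ i, α i = k := by simpa using Fintype.card_congr σ
  refine ⟨α, hα, ?_⟩
  rw [key _ σ hα, partialDeriv]
  congr 1
  funext j
  exact congrArg (fun i => EuclideanSpace.single i (1 : ℝ)) (hτ (finSigmaFinEquiv.symm j))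

theorem norm_iteratedFDeriv_le_of_partialDeriv {n : ℕ} {f : EuclideanSpace ℝ (Fin n) → ℝ}
    {U : Set (EuclideanSpace ℝ (Fin n))} (hU : IsOpen U) (hf : ContDiffOn ℝ ∞ f U)
    {x : EuclideanSpace ℝ (Fin n)} (hx : x ∈ U) {k : ℕ} {B : ℝ} (hB : 0 ≤ B)
    (h : ∀ α : Fin n → ℕ, ∑ i, α i = k → |partialDeriv α f x| ≤ B) :
    ‖iteratedFDeriv ℝ k f x‖ ≤ (n : ℝ) ^ k * B := by
  refine ContinuousMultilinearMap.opNorm_le_bound (by positivity) fun v => ?_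
  have hv : ∀ j, v j = ∑ i, v j i • EuclideanSpace.single i (1 : ℝ) := by
    intro j
    simpa using ((EuclideanSpace.basisFun (Fin n) ℝ).sum_repr (v j)).symm
  have hexp : iteratedFDeriv ℝ k f x v = ∑ r : Fin k → Fin n,
      (∏ j, v j (r j)) *
        iteratedFDeriv ℝ k f x (fun j => EuclideanSpace.single (r j) (1 : ℝ)) := by
    conv_lhs => rw [show v = fun j => ∑ i, v j i • EuclideanSpace.single i (1 : ℝ) from funext hv]
    rw [ContinuousMultilinearMap.map_sum]
    refine Finset.sum_congr rfl fun r _ => ?_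
    rw [ContinuousMultilinearMap.map_smul_univ, smul_eq_mul]
  rw [hexp]
  have hterm : ∀ r : Fin k → Fin n, ‖(∏ j, v j (r j)) *
      iteratedFDeriv ℝ k f x (fun j => EuclideanSpace.single (r j) (1 : ℝ))‖ ≤
        (∏ j, ‖v j‖) * B := by
    intro r
    obtain ⟨α, hα, he⟩ := exists_partialDeriv_eq hU hf hx r
    rw [he, norm_mul, norm_prod]
    refine mul_le_mul (Finset.prod_le_prod (fun _ _ => norm_nonneg _) fun j _ =>
      PiLp.norm_apply_le (v j) (r j)) (h α hα) (norm_nonneg _) (by positivity)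
  refine (norm_sum_le_of_le _ fun r _ => hterm r).trans_eq ?_
  simp [Finset.sum_const, mul_comm, mul_assoc, mul_left_comm]

/-! ### A sufficient condition for quasianalyticity -/

/-- A function that is flat at `a` and satisfies analytic bounds `C S^k k!` along a segment
`[a, a + y]` of length less than `1 / S` vanishes at `a + y`. Bounds for infinitely many orders `k`
suffice, since each of them bounds the Taylor remainder. -/
theorem eq_zero_of_flat {n : ℕ} {h : EuclideanSpace ℝ (Fin n) → ℝ}
    {a y : EuclideanSpace ℝ (Fin n)} (hh : ∀ t ∈ Set.Icc (0 : ℝ) 1, ContDiffAt ℝ ∞ h (a + t • y))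
    (hflat : ∀ k, iteratedFDeriv ℝ k h a = 0) {C S : ℝ} (hS : 0 ≤ S)
    (hSy : S * ‖y‖ < 1)
    (hb : ∃ᶠ k in atTop, ∀ t ∈ Set.Icc (0 : ℝ) 1,
      ‖iteratedFDeriv ℝ k h (a + t • y)‖ ≤ C * S ^ k * (k ! : ℝ)) :
    h (a + y) = 0 := by
  have hb' : ∃ᶠ k : ℕ in atTop, |h (a + y)| ≤ C * (k * (S * ‖y‖) ^ k) := by
    refine (hb.and_eventually (eventually_ge_atTop 1)).mono ?_
    rintro k ⟨hk, hk1⟩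
    obtain ⟨m, rfl⟩ : ∃ m, k = m + 1 := ⟨k - 1, by omega⟩
    rw [map_add_eq_sum_add_integral_iteratedFDeriv (n := m)
      fun t ht => (hh t ht).of_le (by exact_mod_cast le_top)]
    simp only [hflat, zero_apply, smul_zero, Finset.sum_const_zero,
      zero_add]
    have hint : ‖∫ t in (0 : ℝ)..1,
        (1 - t) ^ m • iteratedFDeriv ℝ (m + 1) h (a + t • y) (fun _ => y)‖ ≤
          (C * S ^ (m + 1) * ((m + 1)! : ℝ) * ‖y‖ ^ (m + 1)) * |(1 : ℝ) - 0| := by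
      refine intervalIntegral.norm_integral_le_of_norm_le_const fun t ht => ?_
      rw [Set.uIoc_of_le zero_le_one] at ht
      have ht' : t ∈ Set.Icc (0 : ℝ) 1 := ⟨ht.1.le, ht.2⟩
      have h1 : ‖(1 - t) ^ m‖ ≤ 1 := by
        rw [norm_pow]
        refine pow_le_one₀ (norm_nonneg _) ?_
        rw [Real.norm_eq_abs, abs_le]
        constructor <;> linarith [ht'.1, ht'.2]
      have h2 := (iteratedFDeriv ℝ (m + 1) h (a + t • y)).le_opNorm (fun _ => y)
      simp only [Finset.prod_const, Finset.card_univ, Fintype.card_fin] at h2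
      rw [norm_smul]
      calc _ ≤ 1 * (‖iteratedFDeriv ℝ (m + 1) h (a + t • y)‖ * ‖y‖ ^ (m + 1)) := by gcongr
        _ ≤ _ := by rw [one_mul]; gcongr; exact hk t ht'
    rw [← Real.norm_eq_abs, norm_smul, norm_inv, Real.norm_natCast, inv_mul_le_iff₀ (by positivity)]
    refine hint.trans_eq ?_
    rw [Nat.factorial_succ]
    push_cast
    rw [mul_pow]
    simp
    ring
  have hlim : Tendsto (fun k : ℕ => C * (k * (S * ‖y‖) ^ k)) atTop (𝓝 0) := by
    simpa using (tendsto_self_mul_const_pow_of_lt_one (by positivity) hSy).const_mul C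
  by_contra hne
  obtain ⟨k, hk1, hk2⟩ :=
    (hb'.and_eventually (hlim.eventually_lt_const (abs_pos.mpr hne))).exists
  exact absurd hk1 (not_le.mpr hk2)

/-- If `L` is bounded by a geometric sequence along infinitely many indices, then `C^L` is
quasianalytic. -/
theorem isQuasianalytic_of_frequently_le {L : ℕ → ℝ} {R : ℝ} (hR : 0 ≤ R)
    (hL : ∃ᶠ k in atTop, L k ≤ R ^ k) : IsQuasianalytic L := by
  intro n U hU hUc a ha f g hf hg hfg
  set h : EuclideanSpace ℝ (Fin n) → ℝ := f - g
  have hfU : ∀ x ∈ U, ContDiffAt ℝ ∞ f x := fun x hx => hf.1.contDiffAt (hU.mem_nhds hx)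
  have hgU : ∀ x ∈ U, ContDiffAt ℝ ∞ g x := fun x hx => hg.1.contDiffAt (hU.mem_nhds hx)
  have hhU : ∀ x ∈ U, ContDiffAt ℝ ∞ h x := fun x hx => (hfU x hx).sub (hgU x hx)
  have hsub : ∀ x ∈ U, ∀ k, iteratedFDeriv ℝ k h x =
      iteratedFDeriv ℝ k f x - iteratedFDeriv ℝ k g x := fun x hx k =>
    iteratedFDeriv_sub_apply ((hfU x hx).of_le (by exact_mod_cast le_top))
      ((hgU x hx).of_le (by exact_mod_cast le_top))
  have local_zero : ∀ x ∈ U, (∀ k, iteratedFDeriv ℝ k h x = 0) → h =ᶠ[𝓝 x] 0 := by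
    intro x hx hflat
    obtain ⟨ε, hε, hball⟩ := Metric.nhds_basis_closedBall.mem_iff.mp (hU.mem_nhds hx)
    obtain ⟨C₁, hC₁, ρ₁, hρ₁, h₁⟩ := hf.2 _ (isCompact_closedBall x ε) hball
    obtain ⟨C₂, hC₂, ρ₂, hρ₂, h₂⟩ := hg.2 _ (isCompact_closedBall x ε) hball
    set S : ℝ := n * (max ρ₁ ρ₂ * R) with hSdef
    have hS : 0 ≤ S := by positivity
    have hbound : ∀ k, L k ≤ R ^ k → ∀ z ∈ Metric.closedBall x ε,
        ‖iteratedFDeriv ℝ k h z‖ ≤ (C₁ + C₂) * S ^ k * (k ! : ℝ) := by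
      have aux : ∀ (u : EuclideanSpace ℝ (Fin n) → ℝ) (C ρ : ℝ), 0 < C → 0 < ρ →
          ρ ≤ max ρ₁ ρ₂ → ∀ k, L k ≤ R ^ k → ContDiffOn ℝ ∞ u U → ∀ z ∈ U,
          (∀ α : Fin n → ℕ, |partialDeriv α u z| ≤
            C * ρ ^ (∑ i, α i) * ((∑ i, α i)! : ℝ) * L (∑ i, α i)) →
          ‖iteratedFDeriv ℝ k u z‖ ≤ C * S ^ k * (k ! : ℝ) := by
        intro u C ρ _ hρ hρm k hk hu z hzU hz
        refine (norm_iteratedFDeriv_le_of_partialDeriv hU hu hzU (k := k)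
          (B := C * (max ρ₁ ρ₂) ^ k * (k ! : ℝ) * R ^ k) (by positivity) ?_).trans_eq ?_
        · rintro α rfl
          refine (hz α).trans ?_
          calc _ ≤ C * ρ ^ (∑ i, α i) * ((∑ i, α i)! : ℝ) * R ^ (∑ i, α i) := by gcongr
            _ ≤ _ := by gcongr
        · rw [hSdef, mul_pow, mul_pow]; ring
      intro k hk z hz
      rw [hsub z (hball hz), add_mul, add_mul]
      exact (norm_sub_le _ _).trans (add_le_add
        (aux f C₁ ρ₁ hC₁ hρ₁ (le_max_left _ _) k hk hf.1 z (hball hz) fun α => h₁ α z hz)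
        (aux g C₂ ρ₂ hC₂ hρ₂ (le_max_right _ _) k hk hg.1 z (hball hz) fun α => h₂ α z hz))
    have hsmall : ∀ᶠ z in 𝓝 x, S * ‖z - x‖ < 1 := by
      have : Tendsto (fun z => S * ‖z - x‖) (𝓝 x) (𝓝 (S * ‖x - x‖)) :=
        Continuous.tendsto (by fun_prop) x
      exact this.eventually_lt_const (by simp)
    filter_upwards [hsmall, Metric.closedBall_mem_nhds x hε] with z hz hzε
    have hseg : ∀ t ∈ Set.Icc (0 : ℝ) 1, x + t • (z - x) ∈ Metric.closedBall x ε := by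
      intro t ht
      exact (convex_closedBall x ε).add_smul_sub_mem (Metric.mem_closedBall_self hε.le) hzε ht
    have := eq_zero_of_flat (fun t ht => hhU _ (hball (hseg t ht))) hflat
      (C := C₁ + C₂) hS hz
      (hL.mono fun k hk t ht => hbound k hk _ (hseg t ht))
    simpa using this
  have hflat_a : ∀ k, iteratedFDeriv ℝ k h a = 0 := by
    intro k
    have hz := norm_iteratedFDeriv_le_of_partialDeriv hU (f := h) (hf.1.sub hg.1) ha (k := k) le_rfl
      (fun α _ => by
        have := hfg α
        unfold partialDeriv at this ⊢
        rw [hsub a ha, sub_apply, this, sub_self, abs_zero])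
    rw [mul_zero] at hz
    exact norm_le_zero_iff.mp hz
  -- The set of points near which `f` and `g` agree is open, and closed in `U` since all derivatives
  -- of `f - g` are continuous.
  have hsubset : U ⊆ {x | h =ᶠ[𝓝 x] 0} := by
    refine hUc.isPreconnected.subset_of_closure_inter_subset isOpen_setOfPred_eventually_nhds
      ⟨a, ha, local_zero a ha hflat_a⟩ ?_
    rintro x ⟨hxc, hxU⟩
    refine local_zero x hxU fun k => ?_
    have hcont : ContinuousAt (iteratedFDeriv ℝ k h) x :=
      ((hhU x hxU).iteratedFDeriv_right (i := k) (m := 0)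
        (by simpa using mod_cast le_top)).continuousAt
    have hmem := mem_closure_iff_frequently.mp hxc
    by_contra hne
    obtain ⟨y, hy, hy'⟩ := (hmem.and_eventually (hcont.eventually_ne hne)).exists
    apply hy'
    have h0 : h =ᶠ[𝓝 y] 0 := hy
    rw [(h0.iteratedFDeriv ℝ k).eq_of_nhds]
    simp [Pi.zero_def]
  intro x hx
  have : h x = 0 := (hsubset hx).self_of_nhds
  exact sub_eq_zero.mp this

/-! ### Moving averages -/

/-- The average of `f` over the interval `[x - a, x]` of length `a > 0` to the left of `x`. -/
def movingAverageFun (a : ℝ) (f : ℝ → ℝ) (x : ℝ) : ℝ := a⁻¹ * ∫ t in (x - a)..x, f t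

theorem hasDerivAt_movingAverageFun (a : ℝ) {f : ℝ → ℝ} (hf : Continuous f) (x : ℝ) :
    HasDerivAt (movingAverageFun a f) (a⁻¹ * (f x - f (x - a))) x := by
  have hF : ∀ y, HasDerivAt (fun y => ∫ t in (0 : ℝ)..y, f t) (f y) y := fun y =>
    intervalIntegral.integral_hasDerivAt_right (hf.intervalIntegrable _ _)
      (hf.stronglyMeasurableAtFilter _ _) hf.continuousAt
  have h2 : HasDerivAt (fun y => ∫ t in (0 : ℝ)..(y - a), f t) (f (x - a)) x :=
    (hF (x - a)).comp_sub_const x a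
  refine (((hF x).sub h2).const_mul a⁻¹).congr_of_eventuallyEq (Eventually.of_forall fun y => ?_)
  simp only [movingAverageFun, Pi.sub_apply]
  rw [intervalIntegral.integral_interval_sub_left (hf.intervalIntegrable _ _)
    (hf.intervalIntegrable _ _)]

theorem abs_movingAverageFun_le {a : ℝ} (ha : 0 < a) {f : ℝ → ℝ} {x B : ℝ}
    (hB : ∀ t ∈ Set.Icc (x - a) x, |f t| ≤ B) : |movingAverageFun a f x| ≤ B := by
  have h := intervalIntegral.norm_integral_le_of_norm_le_const (f := f) (a := x - a) (b := x)
    (C := B) fun t ht => by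
      rw [Set.uIoc_of_le (by linarith)] at ht
      exact hB t ⟨ht.1.le, ht.2⟩
  rw [movingAverageFun, abs_mul, abs_inv, abs_of_pos ha, inv_mul_le_iff₀ ha, mul_comm a]
  simpa [abs_of_pos ha] using h

theorem movingAverageFun_sub {a : ℝ} {f g : ℝ → ℝ} (hf : Continuous f) (hg : Continuous g)
    (x : ℝ) : movingAverageFun a f x - movingAverageFun a g x =
      movingAverageFun a (fun t => f t - g t) x := by
  rw [movingAverageFun, movingAverageFun, movingAverageFun, intervalIntegral.integral_sub
    (hf.intervalIntegrable _ _) (hg.intervalIntegrable _ _), mul_sub]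

theorem movingAverageFun_const {a : ℝ} (ha : 0 < a) (c x : ℝ) :
    movingAverageFun a (fun _ => c) x = c := by
  simp [movingAverageFun, ha.ne']

/-- The moving average as a non-expansive self-map of the bounded continuous functions. -/
def movingAverage (a : {a : ℝ // 0 < a}) (f : ℝ →ᵇ ℝ) : ℝ →ᵇ ℝ :=
  BoundedContinuousFunction.ofNormedAddCommGroup (movingAverageFun a f)
    (continuous_iff_continuousAt.mpr fun x =>
      (hasDerivAt_movingAverageFun a f.continuous x).continuousAt) ‖f‖
    fun _ => abs_movingAverageFun_le a.2 fun t _ => f.norm_coe_le_norm t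

@[simp] theorem movingAverage_apply (a : {a : ℝ // 0 < a}) (f : ℝ →ᵇ ℝ) (x : ℝ) :
    movingAverage a f x = movingAverageFun a f x := rfl

theorem dist_movingAverage_le (a : {a : ℝ // 0 < a}) (f g : ℝ →ᵇ ℝ) :
    dist (movingAverage a f) (movingAverage a g) ≤ dist f g := by
  refine (BoundedContinuousFunction.dist_le dist_nonneg).mpr fun x => ?_
  rw [Real.dist_eq, movingAverage_apply, movingAverage_apply,
    movingAverageFun_sub f.continuous g.continuous]
  exact abs_movingAverageFun_le a.2 fun t _ => f.dist_coe_le_dist t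

/-- The function that is `0` on `x ≤ 0`, the identity on `[0, T]` and `T` on `x ≥ T`. Only its being
`1`-Lipschitz, zero on the left and `T` at `T` matters, where `T > 0`. -/
def ramp (T : ℝ) : ℝ →ᵇ ℝ :=
  BoundedContinuousFunction.ofNormedAddCommGroup (fun x => max 0 (min x T)) (by fun_prop) |T|
    fun x => by
      rw [Real.norm_eq_abs, abs_of_nonneg (le_max_left _ _)]
      exact max_le (abs_nonneg _) ((min_le_right _ _).trans (le_abs_self T))

theorem ramp_apply (T x : ℝ) : ramp T x = max 0 (min x T) := rfl

theorem dist_movingAverage_ramp_le (a : {a : ℝ // 0 < a}) (T : ℝ) :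
    dist (movingAverage a (ramp T)) (ramp T) ≤ a := by
  refine (BoundedContinuousFunction.dist_le a.2.le).mpr fun x => ?_
  rw [Real.dist_eq, movingAverage_apply, ← movingAverageFun_const a.2 (ramp T x) x,
    movingAverageFun_sub (ramp T).continuous continuous_const]
  refine abs_movingAverageFun_le a.2 fun t ht => ?_
  rw [ramp_apply, ramp_apply]
  calc |max 0 (min t T) - max 0 (min x T)| ≤ |min t T - min x T| := by
        rw [max_comm, max_comm 0]; exact abs_max_sub_max_le_abs _ _ _
    _ ≤ |t - x| := by simpa using abs_min_sub_min_le_max t T x T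
    _ ≤ a := by rw [abs_le]; constructor <;> linarith [ht.1, ht.2]

/-! ### A flat function with prescribed derivative bounds -/

/-- The ramp averaged over lengths `a (m + n - 1)`, …, `a (m + 1)`, `a m`, in this order, so that
the averaging over length `a m` is the outermost one. -/
def averagedRamp (a : ℕ → {a : ℝ // 0 < a}) (T : ℝ) : ℕ → ℕ → (ℝ →ᵇ ℝ)
  | 0, _ => ramp T
  | n + 1, m => movingAverage (a m) (averagedRamp a T n (m + 1))

section

variable (a : ℕ → {a : ℝ // 0 < a}) (T : ℝ)

theorem dist_averagedRamp_succ_le (n m : ℕ) :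
    dist (averagedRamp a T n m) (averagedRamp a T (n + 1) m) ≤ a (n + m) := by
  induction n generalizing m with
  | zero =>
    rw [dist_comm, zero_add]
    simpa only [averagedRamp, zero_add] using dist_movingAverage_ramp_le (a m) T
  | succ n ih =>
    refine (dist_movingAverage_le (a m) _ _).trans ((ih (m + 1)).trans_eq ?_)
    rw [show n + (m + 1) = n + 1 + m by ring]

theorem averagedRamp_eq_zero (n m : ℕ) {x : ℝ} (hx : x ≤ 0) : averagedRamp a T n m x = 0 := by
  induction n generalizing m x with
  | zero => exact max_eq_left ((min_le_left _ _).trans hx)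
  | succ n ih =>
    refine abs_nonpos_iff.mp (abs_movingAverageFun_le (a m).2 fun t ht => ?_)
    rw [ih (m + 1) (ht.2.trans hx), abs_zero]

theorem abs_averagedRamp_le {T : ℝ} (hT : 0 ≤ T) (n m : ℕ) (x : ℝ) :
    |averagedRamp a T n m x| ≤ T := by
  induction n generalizing m x with
  | zero =>
    rw [averagedRamp, ramp_apply, abs_of_nonneg (le_max_left _ _)]
    exact max_le hT (min_le_right _ _)
  | succ n ih => exact abs_movingAverageFun_le (a m).2 fun t _ => ih (m + 1) t

/-- The limits of the averaged ramps: a family in which each member is the moving average of the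
next one. The first is not zero because the averages move the ramp by at most `∑ a m < T` in
total, and the ramp takes the value `T`. -/
theorem exists_movingAverage_fixed_family (ha : Summable fun m => (a m : ℝ)) {T : ℝ}
    (hT : ∑' m, (a m : ℝ) < T) :
    ∃ u : ℕ → (ℝ →ᵇ ℝ), (∀ m, u m = movingAverage (a m) (u (m + 1))) ∧
      (∀ m x, x ≤ 0 → u m x = 0) ∧ (∀ m x, |u m x| ≤ T) ∧ u 0 T ≠ 0 := by
  have hT0 : 0 < T := (tsum_nonneg fun m => (a m).2.le).trans_lt hT
  have hlim : ∀ m, ∃ v, Tendsto (fun n => averagedRamp a T n m) atTop (𝓝 v) := fun m =>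
    cauchySeq_tendsto_of_complete (cauchySeq_of_dist_le_of_summable (fun n => (a (n + m) : ℝ))
      (fun n => dist_averagedRamp_succ_le a T n m) ((summable_nat_add_iff m).mpr ha))
  choose u hu using hlim
  have hpt : ∀ m x, Tendsto (fun n => averagedRamp a T n m x) atTop (𝓝 (u m x)) := fun m x =>
    ((BoundedContinuousFunction.lipschitz_eval_const x).continuous.tendsto (u m)).comp (hu m)
  refine ⟨u, fun m => ?_, fun m x hx => ?_, fun m x => ?_, fun h0 => ?_⟩
  · have hc : Continuous (movingAverage (a m)) :=
      (LipschitzWith.of_dist_le_mul (K := 1) fun f g => by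
        simpa using dist_movingAverage_le (a m) f g).continuous
    exact tendsto_nhds_unique ((hu m).comp (tendsto_add_atTop_nat 1))
      ((hc.tendsto _).comp (hu (m + 1)))
  · refine tendsto_nhds_unique (hpt m x) ?_
    simp [averagedRamp_eq_zero a T _ m hx]
  · exact le_of_tendsto (hpt m x).abs (Eventually.of_forall fun n =>
      abs_averagedRamp_le a hT0.le n m x)
  · have h1 := dist_le_tsum_of_dist_le_of_tendsto₀ _
      (fun n => dist_averagedRamp_succ_le a T n 0) (by simpa using ha) (hu 0)
    have h2 := (BoundedContinuousFunction.dist_coe_le_dist (f := ramp T) (g := u 0) T).trans h1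
    rw [h0, ramp_apply, min_self, max_eq_right hT0.le, Real.dist_eq, sub_zero,
      abs_of_pos hT0] at h2
    simp only [add_zero] at h2
    linarith

variable {a}

/-- By induction on `k`, for all members at once: the derivative of `u m` at `x` is the difference
quotient `(u (m + 1) x - u (m + 1) (x - a m)) / a m`. -/
theorem smooth_of_movingAverage_family {T : ℝ} {u : ℕ → (ℝ →ᵇ ℝ)}
    (hrec : ∀ m, u m = movingAverage (a m) (u (m + 1)))
    (hzero : ∀ m x, x ≤ 0 → u m x = 0) (hbd : ∀ m x, |u m x| ≤ T) (k : ℕ) :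
    ∀ m, ContDiff ℝ k (u m) ∧ (∀ x ≤ 0, iteratedDeriv k (u m) x = 0) ∧
      ∀ x, |iteratedDeriv k (u m) x| ≤ T * ∏ i ∈ Finset.range k, (2 / (a (m + i) : ℝ)) := by
  induction k with
  | zero =>
    intro m
    refine ⟨?_, fun x hx => ?_, fun x => ?_⟩
    · exact_mod_cast contDiff_zero.mpr (u m).continuous
    · simpa using hzero m x hx
    · simpa using hbd m x
  | succ k ih =>
    intro m
    have hder : ∀ x, HasDerivAt (u m) ((a m : ℝ)⁻¹ * (u (m + 1) x - u (m + 1) (x - a m))) x := by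
      intro x
      have := hasDerivAt_movingAverageFun (a m) (u (m + 1)).continuous x
      rw [hrec m]
      exact this
    have hderiv : deriv (u m) =
        fun x => (a m : ℝ)⁻¹ * (u (m + 1) x - u (m + 1) (x - a m)) :=
      funext fun x => (hder x).deriv
    obtain ⟨hs, hz, hb⟩ := ih (m + 1)
    have hs' : ContDiff ℝ k fun x => u (m + 1) (x - a m) := hs.comp (contDiff_id.sub contDiff_const)
    have hit : ∀ x, iteratedDeriv (k + 1) (u m) x = (a m : ℝ)⁻¹ *
        (iteratedDeriv k (u (m + 1)) x - iteratedDeriv k (u (m + 1)) (x - a m)) := by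
      intro x
      rw [iteratedDeriv_succ', hderiv, iteratedDeriv_const_mul_field,
        iteratedDeriv_fun_sub hs.contDiffAt hs'.contDiffAt,
        iteratedDeriv_comp_sub_const]
    refine ⟨?_, fun x hx => ?_, fun x => ?_⟩
    · rw [Nat.cast_add, Nat.cast_one, contDiff_succ_iff_deriv]
      refine ⟨fun x => (hder x).differentiableAt, by simp, ?_⟩
      rw [hderiv]
      exact contDiff_const.mul (hs.sub hs')
    · rw [hit, hz x hx, hz (x - a m) (by linarith [(a m).2]), sub_zero, mul_zero]
    · rw [hit, abs_mul, abs_of_pos (inv_pos.mpr (a m).2), inv_mul_le_iff₀ (a m).2,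
        Finset.prod_range_succ']
      have e : ∏ i ∈ Finset.range k, (2 / (a (m + (i + 1)) : ℝ)) =
          ∏ i ∈ Finset.range k, (2 / (a (m + 1 + i) : ℝ)) :=
        Finset.prod_congr rfl fun i _ => by rw [show m + (i + 1) = m + 1 + i by ring]
      have ha0 : (a m : ℝ) ≠ 0 := (a m).2.ne'
      rw [e]
      calc _ ≤ _ := abs_sub _ _
        _ ≤ _ := add_le_add (hb x) (hb _)
        _ = _ := by rw [add_zero]; field_simp; ring

end

theorem exists_flat_function {ℓ : ℕ → ℝ} (hℓ : ∀ k, 0 < ℓ k) (hs : Summable fun k => (ℓ k)⁻¹) :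
    ∃ u : ℝ → ℝ, ContDiff ℝ ∞ u ∧ (∀ k, iteratedDeriv k u 0 = 0) ∧ u ≠ 0 ∧
      ∃ T > 0, ∀ k x, |iteratedDeriv k u x| ≤ T * 2 ^ k * ∏ i ∈ Finset.range k, ℓ i := by
  let a : ℕ → {a : ℝ // 0 < a} := fun k => ⟨(ℓ k)⁻¹, inv_pos.mpr (hℓ k)⟩
  have hT : ∑' m, (a m : ℝ) < ∑' m, (a m : ℝ) + 1 := lt_add_one _
  have hT0 : 0 ≤ ∑' m, (a m : ℝ) := tsum_nonneg fun m => (a m).2.le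
  obtain ⟨u, hrec, hzero, hbd, hne⟩ := exists_movingAverage_fixed_family a hs hT
  have key := fun k => smooth_of_movingAverage_family hrec hzero hbd k 0
  refine ⟨u 0, contDiff_infty.mpr fun k => (key k).1, fun k => (key k).2.1 0 le_rfl,
    fun h => hne (congrFun h _), _, add_pos_of_nonneg_of_pos hT0 one_pos,
    fun k x => ((key k).2.2 x).trans_eq ?_⟩
  simp [a, Finset.prod_mul_distrib, mul_assoc]

/-! ### A sufficient condition for non-quasianalyticity -/

theorem partialDeriv_comp_apply_zero {u : ℝ → ℝ} (hu : ContDiff ℝ ∞ u) (α : Fin 1 → ℕ)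
    (x : EuclideanSpace ℝ (Fin 1)) :
    partialDeriv α (fun y => u (y 0)) x = iteratedDeriv (∑ i, α i) u (x 0) := by
  let p : EuclideanSpace ℝ (Fin 1) →L[ℝ] ℝ := EuclideanSpace.proj 0
  have h := p.iteratedFDeriv_comp_right hu x (i := ∑ i, α i) (by exact_mod_cast le_top)
  have hp : (fun y : EuclideanSpace ℝ (Fin 1) => u (y 0)) = u ∘ p := rfl
  rw [partialDeriv, hp, h, iteratedDeriv]
  simp only [ContinuousMultilinearMap.compContinuousLinearMap_apply]
  congr 1
  funext j
  simp [p, Subsingleton.elim (finSigmaFinEquiv.symm j).1 (0 : Fin 1)]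

/-- The elementary half of the Denjoy--Carleman theorem: if the quotients
`(k + 1)! L_(k+1) / (k! L_k)` have summable reciprocals, then there is a nonzero function of class
`C^L` on the line that is flat at the origin. -/
theorem not_isQuasianalytic_of_summable {L : ℕ → ℝ} (hL : ∀ k, 0 < L k)
    (hs : Summable fun k : ℕ => L k / ((k + 1) * L (k + 1))) : ¬ IsQuasianalytic L := by
  intro hq
  obtain ⟨u, hu, hflat, hne, T, hT, hbd⟩ :=
    exists_flat_function (ℓ := fun k : ℕ => (k + 1) * L (k + 1) / L k)
      (fun k => by have := hL k; have := hL (k + 1); positivity) (by simpa using hs)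
  have hprod : ∀ k, ∏ i ∈ Finset.range k, (((i : ℝ) + 1) * L (i + 1) / L i) =
      (k ! : ℝ) * L k / L 0 := by
    intro k
    induction k with
    | zero => simp [(hL 0).ne']
    | succ k ih =>
      have := (hL k).ne'
      have := (hL 0).ne'
      rw [Finset.prod_range_succ, ih, Nat.factorial_succ]
      push_cast
      field_simp
  let F : EuclideanSpace ℝ (Fin 1) → ℝ := fun y => u (y 0)
  have hF : IsDenjoyCarleman L Set.univ F := by
    refine ⟨(hu.comp (EuclideanSpace.proj (𝕜 := ℝ) (0 : Fin 1)).contDiff).contDiffOn,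
      fun K _ _ => ⟨T / L 0, div_pos hT (hL 0), 2, two_pos, fun α x _ => ?_⟩⟩
    rw [partialDeriv_comp_apply_zero hu]
    refine (hbd _ _).trans_eq ?_
    rw [hprod]
    ring
  have h0 : ∀ α : Fin 1 → ℕ, ∀ x, partialDeriv α (0 : EuclideanSpace ℝ (Fin 1) → ℝ) x = 0 := by
    intro α x
    simp [partialDeriv, Pi.zero_def]
  have hZ : IsDenjoyCarleman L Set.univ (0 : EuclideanSpace ℝ (Fin 1) → ℝ) :=
    ⟨contDiff_const.contDiffOn, fun K _ _ => ⟨1, one_pos, 1, one_pos, fun α x _ => by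
      rw [h0, abs_zero]
      have := hL (∑ i, α i)
      positivity⟩⟩
  have heq := hq 1 Set.univ isOpen_univ isConnected_univ 0 (Set.mem_univ _) F 0 hF hZ fun α => by
    rw [h0, partialDeriv_comp_apply_zero hu]
    exact hflat _
  refine hne (funext fun t => ?_)
  simpa [F] using heq (Set.mem_univ (EuclideanSpace.single (0 : Fin 1) t))

/-! ### Comparison of sequences and sequence spaces -/

theorem IsWeightSequence.monotone {Q : ℕ → ℝ} (hQ : IsWeightSequence Q) : Monotone Q := by
  refine monotone_nat_of_le_succ fun k => ?_
  induction k with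
  | zero => rw [hQ.zero_eq_one]; exact hQ.one_le_one
  | succ k ih =>
    have h1 := hQ.logConvex k
    have h2 := hQ.pos (k + 1)
    have h3 := hQ.pos (k + 2)
    have h4 : Q (k + 1) * Q (k + 1) ≤ Q (k + 1) * Q (k + 2) := by
      rw [← sq]; exact h1.trans (mul_le_mul_of_nonneg_right ih h3.le)
    exact le_of_mul_le_mul_left h4 h2

theorem mem_seqSpace {M f : ℕ → ℝ} : f ∈ seqSpace M ↔
    ∃ ρ > (0 : ℝ), ∃ C > (0 : ℝ), ∀ k : ℕ, |f k| ≤ C * ρ ^ k * (k ! : ℝ) * M k := by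
  simp [seqSpace, seqSpaceRho]

theorem seqSpace_subset_of_le {M L : ℕ → ℝ} {c : ℝ} (hc : 0 < c) (h : ∀ k, M k ≤ c * L k) :
    seqSpace M ⊆ seqSpace L := by
  intro f hf
  obtain ⟨ρ, hρ, C, hC, hb⟩ := mem_seqSpace.mp hf
  refine mem_seqSpace.mpr ⟨ρ, hρ, C * c, by positivity, fun k => (hb k).trans ?_⟩
  calc C * ρ ^ k * (k ! : ℝ) * M k ≤ C * ρ ^ k * (k ! : ℝ) * (c * L k) := by
        gcongr; exact h k
    _ = _ := by ring

theorem frequently_lt_of_notMem_seqSpace {M f : ℕ → ℝ} (hM : ∀ k, 0 < M k) (hf : f ∉ seqSpace M)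
    {R : ℝ} (hR : 0 < R) : ∃ᶠ k in atTop, R ^ k * (k ! : ℝ) * M k < |f k| := by
  by_contra hcon
  rw [not_frequently, eventually_atTop] at hcon
  obtain ⟨N, hN⟩ := hcon
  have hpos : ∀ k, 0 < R ^ k * (k ! : ℝ) * M k := fun k => by
    have := hM k; positivity
  have hsum : ∀ k, 0 ≤ |f k| / (R ^ k * (k ! : ℝ) * M k) := fun k =>
    div_nonneg (abs_nonneg _) (hpos k).le
  have hS := Finset.sum_nonneg fun k (_ : k ∈ Finset.range N) => hsum k
  refine hf (mem_seqSpace.mpr ⟨R, hR,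
    1 + ∑ k ∈ Finset.range N, |f k| / (R ^ k * (k ! : ℝ) * M k), by linarith, fun k => ?_⟩)
  rw [mul_assoc, mul_assoc, ← mul_assoc (R ^ k), ← div_le_iff₀ (hpos k)]
  rcases lt_or_ge k N with hk | hk
  · have := Finset.single_le_sum (fun i _ => hsum i) (Finset.mem_range.mpr hk)
    linarith
  · have : |f k| / (R ^ k * (k ! : ℝ) * M k) ≤ 1 := (div_le_one (hpos k)).mpr (not_lt.mp (hN k hk))
    linarith

/-! ### The majorant adapted to a sparse sequence of indices -/

/-- The sum of `2^-(j+1) / κ_j` over the `j` with `i ≤ κ_j`. For strictly increasing `κ` and `i ≥ 1`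
it is positive, nonincreasing in `i` and at most `1 / i`; it is at least `2^-(j+1) / κ_j` for
`i ≤ κ_j`; and its total over `i ≥ 1` is at most `1`, since the `j`-th term occurs for `κ_j` values of `i`. -/
def stepSum (κ : ℕ → ℕ) (i : ℕ) : ℝ := ∑' j, if i ≤ κ j then (1 / 2 : ℝ) ^ (j + 1) / κ j else 0

section stepSum
variable {κ : ℕ → ℕ}

theorem summable_half_pow_succ : Summable fun j : ℕ => (1 / 2 : ℝ) ^ (j + 1) :=
  (summable_nat_add_iff 1).mpr summable_geometric_two

theorem tsum_half_pow_succ : ∑' j : ℕ, (1 / 2 : ℝ) ^ (j + 1) = 1 := by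
  simp_rw [pow_succ, tsum_mul_right, tsum_geometric_two]
  norm_num

theorem stepSum_term_nonneg (i j : ℕ) :
    0 ≤ if i ≤ κ j then (1 / 2 : ℝ) ^ (j + 1) / κ j else 0 := by
  split_ifs <;> positivity

theorem stepSum_term_le {i : ℕ} (hi : 0 < i) (j : ℕ) :
    (if i ≤ κ j then (1 / 2 : ℝ) ^ (j + 1) / κ j else 0) ≤ (1 / 2 : ℝ) ^ (j + 1) / i := by
  split_ifs with h
  · gcongr
  · positivity

theorem summable_stepSum {i : ℕ} (hi : 0 < i) :
    Summable fun j => if i ≤ κ j then (1 / 2 : ℝ) ^ (j + 1) / κ j else 0 :=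
  Summable.of_nonneg_of_le (stepSum_term_nonneg i) (stepSum_term_le hi)
    (summable_half_pow_succ.div_const _)

theorem stepSum_le {i : ℕ} (hi : 0 < i) : stepSum κ i ≤ 1 / i := by
  refine ((summable_stepSum hi).tsum_le_tsum (stepSum_term_le hi)
    (summable_half_pow_succ.div_const _)).trans_eq ?_
  rw [tsum_div_const, tsum_half_pow_succ]

theorem le_stepSum {i j : ℕ} (hi : 0 < i) (hij : i ≤ κ j) :
    (1 / 2 : ℝ) ^ (j + 1) / κ j ≤ stepSum κ i := by
  have := (summable_stepSum (κ := κ) hi).le_tsum j fun b _ => stepSum_term_nonneg i b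
  rwa [if_pos hij] at this

theorem stepSum_pos (hκ : StrictMono κ) {i : ℕ} (hi : 0 < i) : 0 < stepSum κ i := by
  refine lt_of_lt_of_le ?_ (le_stepSum hi hκ.le_apply)
  have : 0 < κ i := hi.trans_le hκ.le_apply
  positivity

theorem stepSum_succ_le {i : ℕ} (hi : 0 < i) : stepSum κ (i + 1) ≤ stepSum κ i := by
  refine (summable_stepSum i.succ_pos).tsum_le_tsum (fun j => ?_) (summable_stepSum hi)
  by_cases h : i + 1 ≤ κ j
  · rw [if_pos h, if_pos (Nat.le_of_succ_le h)]
  · rw [if_neg h]; exact stepSum_term_nonneg i j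

theorem summable_stepSum_succ (hκ : StrictMono κ) : Summable fun i => stepSum κ (i + 1) := by
  refine summable_of_sum_range_le (c := 1) (fun i => (stepSum_pos hκ i.succ_pos).le) fun n => ?_
  have hs : ∀ i ∈ Finset.range n, Summable fun j =>
      if i + 1 ≤ κ j then (1 / 2 : ℝ) ^ (j + 1) / κ j else 0 :=
    fun i _ => summable_stepSum i.succ_pos
  unfold stepSum
  rw [← Summable.tsum_finsetSum hs]
  refine (Summable.tsum_le_tsum (fun j => ?_) (summable_sum hs)
    summable_half_pow_succ).trans_eq tsum_half_pow_succ
  rw [← Finset.sum_filter, Finset.sum_const, nsmul_eq_mul]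
  have hcard : ((Finset.range n).filter fun i => i + 1 ≤ κ j).card ≤ κ j := by
    refine (Finset.card_le_card fun i hi => ?_).trans_eq (Finset.card_range (κ j))
    exact Finset.mem_range.mpr (Finset.mem_filter.mp hi).2
  rcases Nat.eq_zero_or_pos (κ j) with h0 | hpos
  · rw [h0]; simp
  · rw [mul_div_left_comm]
    refine mul_le_of_le_one_right (by positivity) ((div_le_one (by positivity)).mpr ?_)
    exact_mod_cast hcard

end stepSum

/-- The sequence `L` with `k! L_k = Q_k ∏ 1 / s_i`, the product over `1 ≤ i ≤ k`, where `s` is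
`stepSum κ`. Its quotients `k L_k / L_(k-1)` are `Q_k / (Q_(k-1) s_k)`. -/
def stretchedMajorant (Q : ℕ → ℝ) (κ : ℕ → ℕ) (k : ℕ) : ℝ :=
  Q k * (∏ i ∈ Finset.range k, (stepSum κ (i + 1))⁻¹) / (k ! : ℝ)

theorem factorial_mul_stretchedMajorant (Q : ℕ → ℝ) (κ : ℕ → ℕ) (k : ℕ) :
    (k ! : ℝ) * stretchedMajorant Q κ k =
      Q k * ∏ i ∈ Finset.range k, (stepSum κ (i + 1))⁻¹ :=
  mul_div_cancel₀ _ (by positivity)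

theorem stretchedMajorant_mem_weakMajorants {Q : ℕ → ℝ} (hQ : IsWeightSequence Q) {κ : ℕ → ℕ}
    (hκ : StrictMono κ) : stretchedMajorant Q κ ∈ weakMajorants Q := by
  have hs : ∀ i, 0 < stepSum κ (i + 1) := fun i => stepSum_pos hκ i.succ_pos
  have hP : ∀ k, 0 < ∏ i ∈ Finset.range k, (stepSum κ (i + 1))⁻¹ := fun k =>
    Finset.prod_pos fun i _ => inv_pos.mpr (hs i)
  have hL : ∀ k, 0 < stretchedMajorant Q κ k := fun k =>
    div_pos (mul_pos (hQ.pos k) (hP k)) (by positivity)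
  refine ⟨hL, fun k => ?_, not_isQuasianalytic_of_summable hL ?_, fun k => ?_⟩
  · have hfac : (k ! : ℝ) ≤ ∏ i ∈ Finset.range k, (stepSum κ (i + 1))⁻¹ := by
      rw [← Finset.prod_range_add_one_eq_factorial]
      push_cast
      refine Finset.prod_le_prod (fun i _ => by positivity) fun i _ => ?_
      rw [le_inv_comm₀ (by positivity) (hs i)]
      simpa using stepSum_le (κ := κ) i.succ_pos
    rw [stretchedMajorant, le_div_iff₀ (by positivity)]
    exact mul_le_mul_of_nonneg_left hfac (hQ.pos k).le
  · refine Summable.of_nonneg_of_le (fun k => ?_) (fun k => ?_) (summable_stepSum_succ hκ)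
    · have := hL k; have := hL (k + 1); positivity
    · have h1 := hs k
      have h2 := hP k
      have h3 := hQ.pos (k + 1)
      have h4 := hQ.monotone k.le_succ
      rw [div_le_iff₀ (by have := hL (k + 1); positivity)]
      have e : stepSum κ (k + 1) * (((k : ℝ) + 1) * stretchedMajorant Q κ (k + 1)) =
          Q (k + 1) * (∏ i ∈ Finset.range k, (stepSum κ (i + 1))⁻¹) / (k ! : ℝ) := by
        rw [stretchedMajorant, Finset.prod_range_succ, Nat.factorial_succ]
        push_cast
        field_simp
      rw [e, stretchedMajorant]
      gcongr
  · simp only [factorial_mul_stretchedMajorant, Finset.prod_range_succ]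
    set P := ∏ i ∈ Finset.range k, (stepSum κ (i + 1))⁻¹
    have hPk : 0 < P := hP k
    have h1 := inv_pos.mpr (hs k)
    have h2 := inv_pos.mpr (hs (k + 1))
    have h3 : (stepSum κ (k + 1))⁻¹ ≤ (stepSum κ (k + 1 + 1))⁻¹ :=
      inv_anti₀ (hs (k + 1)) (stepSum_succ_le k.succ_pos)
    have h4 := hQ.pos k
    have h5 := hQ.pos (k + 2)
    calc (Q (k + 1) * (P * (stepSum κ (k + 1))⁻¹)) ^ 2
        = Q (k + 1) ^ 2 * (P ^ 2 * (stepSum κ (k + 1))⁻¹ * (stepSum κ (k + 1))⁻¹) := by ring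
      _ ≤ (Q k * Q (k + 2)) *
          (P ^ 2 * (stepSum κ (k + 1))⁻¹ * (stepSum κ (k + 1 + 1))⁻¹) := by
        gcongr
        exact hQ.logConvex k
      _ = _ := by ring

/-- At the indices `κ_j` the majorant exceeds `Q` by no more than a geometric factor of ratio
`2^(j+1) e`, because all factors `1 / s_i` are at most `2^(j+1) κ_j` there and `k^k ≤ e^k k!`. -/
theorem factorial_mul_stretchedMajorant_le {Q : ℕ → ℝ} (hQ : ∀ k, 0 ≤ Q k) {κ : ℕ → ℕ}
    (hκ : StrictMono κ) (j : ℕ) :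
    ((κ j)! : ℝ) * stretchedMajorant Q κ (κ j) ≤
      (2 ^ (j + 1) * Real.exp 1) ^ κ j * ((κ j)! : ℝ) * Q (κ j) := by
  have hprod : ∏ i ∈ Finset.range (κ j), (stepSum κ (i + 1))⁻¹ ≤
      (2 ^ (j + 1) * (κ j : ℝ)) ^ κ j := by
    refine (Finset.prod_le_prod (g := fun _ => 2 ^ (j + 1) * (κ j : ℝ))
      (fun i _ => (inv_pos.mpr (stepSum_pos hκ i.succ_pos)).le) fun i hi => ?_).trans_eq (by simp)
    have hi' : i + 1 ≤ κ j := Finset.mem_range.mp hi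
    have hpos : 0 < κ j := by omega
    rw [inv_le_comm₀ (stepSum_pos hκ i.succ_pos) (by positivity)]
    refine le_trans (le_of_eq ?_) (le_stepSum i.succ_pos hi')
    rw [one_div, inv_pow, mul_inv, div_eq_mul_inv]
  have hexp : (κ j : ℝ) ^ κ j ≤ Real.exp 1 ^ κ j * ((κ j)! : ℝ) := by
    rw [← div_le_iff₀ (by positivity), ← Real.exp_nat_mul, mul_one]
    exact Real.pow_div_factorial_le_exp _ (by positivity) _
  rw [factorial_mul_stretchedMajorant, mul_comm (Q _)]
  refine mul_le_mul_of_nonneg_right (hprod.trans ?_) (hQ _)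
  rw [mul_pow, mul_pow, mul_assoc]
  gcongr

theorem seqSpace_eq_iInter_weakMajorants {Q : ℕ → ℝ} (hQ : IsWeightSequence Q) :
    seqSpace Q = ⋂ L ∈ weakMajorants Q, seqSpace L := by
  refine Set.Subset.antisymm (Set.subset_iInter₂ fun L hL =>
    seqSpace_subset_of_le one_pos fun k => by simpa using hL.2.1 k) fun f hf => ?_
  by_contra hfQ
  obtain ⟨κ, hκ, hfκ⟩ := extraction_forall_of_frequently fun j : ℕ =>
    frequently_lt_of_notMem_seqSpace hQ.pos hfQ (R := (4 : ℝ) ^ j) (by positivity)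
  have hL := stretchedMajorant_mem_weakMajorants hQ hκ
  obtain ⟨ρ, hρ, C, hC, hb⟩ := mem_seqSpace.mp (Set.mem_iInter₂.mp hf _ hL)
  obtain ⟨j, hj⟩ := pow_unbounded_of_one_lt (max C 1 * (2 * Real.exp 1 * ρ)) one_lt_two
  have hj1 : (2 : ℝ) ^ j ≤ 2 ^ (j + 1) := pow_le_pow_right₀ one_le_two j.le_succ
  -- At `κ (j + 1)` rather than `κ j`, so that `k` is positive and `C` can be absorbed in a `k`-th
  -- power.
  set k := κ (j + 1)
  have hkpos : k ≠ 0 := by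
    have : j + 1 ≤ k := hκ.le_apply
    omega
  have hCk : C ≤ max C 1 ^ k :=
    (le_max_left C 1).trans (le_self_pow₀ (le_max_right C 1) hkpos)
  have h1 := hfκ (j + 1)
  have h2 := hb k
  have h3 := factorial_mul_stretchedMajorant_le (fun k => (hQ.pos k).le) hκ (j + 1)
  have hQk := hQ.pos k
  have hLk := hL.1 k
  refine absurd (h1.trans_le h2) (not_lt.mpr ?_)
  calc C * ρ ^ k * (k ! : ℝ) * stretchedMajorant Q κ k
      = C * ρ ^ k * ((k ! : ℝ) * stretchedMajorant Q κ k) := by ring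
    _ ≤ max C 1 ^ k * ρ ^ k *
        ((2 ^ (j + 1 + 1) * Real.exp 1) ^ k * (k ! : ℝ) * Q k) := by gcongr
    _ = ((max C 1 * (2 * Real.exp 1 * ρ)) * 2 ^ (j + 1)) ^ k * (k ! : ℝ) * Q k := by
      rw [pow_succ 2 (j + 1)]; simp only [mul_pow]; ring
    _ ≤ (2 ^ (j + 1) * 2 ^ (j + 1)) ^ k * (k ! : ℝ) * Q k := by
      gcongr
      exact hj.le.trans hj1
    _ = ((4 : ℝ) ^ (j + 1)) ^ k * (k ! : ℝ) * Q k := by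
      rw [← mul_pow]; norm_num

/-! ### The real-analytic class and Bang's family -/

theorem isWeightSequence_omega : IsWeightSequence omega :=
  ⟨fun _ => one_pos, rfl, le_rfl, fun _ => by simp [omega]⟩

theorem isQuasianalytic_omega : IsQuasianalytic omega :=
  isQuasianalytic_of_frequently_le zero_le_one
    (Frequently.of_forall fun k => (one_pow k).ge)

theorem IsDenjoyCarleman.of_le {M L : ℕ → ℝ} {c : ℝ} (hc : 0 < c) (h : ∀ k, M k ≤ c * L k) {n : ℕ}
    {U : Set (EuclideanSpace ℝ (Fin n))} {f : EuclideanSpace ℝ (Fin n) → ℝ}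
    (hf : IsDenjoyCarleman M U f) : IsDenjoyCarleman L U f := by
  refine ⟨hf.1, fun K hK hKU => ?_⟩
  obtain ⟨C, hC, ρ, hρ, hb⟩ := hf.2 K hK hKU
  refine ⟨C * c, by positivity, ρ, hρ, fun α x hx => (hb α x hx).trans ?_⟩
  calc _ ≤ C * ρ ^ (∑ i, α i) * ((∑ i, α i)! : ℝ) * (c * L (∑ i, α i)) := by gcongr; exact h _
    _ = _ := by ring

theorem IsQuasianalytic.of_le {M L : ℕ → ℝ} (hL : IsQuasianalytic L) {c : ℝ} (hc : 0 < c)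
    (h : ∀ k, M k ≤ c * L k) : IsQuasianalytic M :=
  fun n U hU hUc a ha f g hf hg => hL n U hU hUc a ha f g (hf.of_le hc h)
    (hg.of_le hc h)

/-- The root-free form of `m_k^(1/k) ≤ m_(k+1)^(1/(k+1))`. -/
theorem IsLogConvex.pow_succ_le {m : ℕ → ℝ} (hm : IsLogConvex m) (hpos : ∀ k, 0 < m k)
    (h0 : m 0 = 1) (k : ℕ) : m k ^ (k + 1) ≤ m (k + 1) ^ k := by
  induction k with
  | zero => simp [h0]
  | succ k ih =>
    have h1 := hpos k
    have h2 := hpos (k + 1)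
    have h3 := hpos (k + 2)
    refine le_of_mul_le_mul_left ?_ (pow_pos h2 k)
    calc m (k + 1) ^ k * m (k + 1) ^ (k + 1 + 1) = (m (k + 1) ^ 2) ^ (k + 1) := by ring
      _ ≤ (m k * m (k + 2)) ^ (k + 1) := by gcongr; exact hm k
      _ = m k ^ (k + 1) * m (k + 2) ^ (k + 1) := mul_pow _ _ _
      _ ≤ m (k + 1) ^ k * m (k + 1 + 1) ^ (k + 1) := by gcongr

theorem IsLogConvex.monotoneOn_root {m : ℕ → ℝ} (hm : IsLogConvex m) (hpos : ∀ k, 0 < m k)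
    (h0 : m 0 = 1) :
    MonotoneOn (fun k : ℕ => m k ^ ((1 : ℝ) / (k : ℝ))) (Set.Ici 1) := by
  refine monotoneOn_of_le_succ Set.ordConnected_Ici fun k _ hk _ => ?_
  have hk0 : 0 < (k : ℝ) := by exact_mod_cast (Set.mem_Ici.mp hk)
  have hk1 : 0 < ((k + 1 : ℕ) : ℝ) := by positivity
  have h1 := (hpos k).le
  have h2 := (hpos (k + 1)).le
  have key := hm.pow_succ_le hpos h0 k
  rw [← Real.rpow_natCast, ← Real.rpow_natCast] at key
  have := Real.rpow_le_rpow (by positivity) key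
    (by positivity : 0 ≤ (1 : ℝ) / ((k : ℝ) * ((k + 1 : ℕ) : ℝ)))
  rw [← Real.rpow_mul h1, ← Real.rpow_mul h2] at this
  simp only [Order.succ_eq_add_one]
  have e1 : ((k + 1 : ℕ) : ℝ) * (1 / ((k : ℝ) * ((k + 1 : ℕ) : ℝ))) = 1 / k := by field_simp
  have e2 : (k : ℝ) * (1 / ((k : ℝ) * ((k + 1 : ℕ) : ℝ))) = 1 / ((k + 1 : ℕ) : ℝ) := by field_simp
  rwa [e1, e2] at this

theorem seqSpace_div {L : ℕ → ℝ} {c : ℝ} (hc : 0 < c) :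
    seqSpace (fun k => L k / c) = seqSpace L :=
  Set.Subset.antisymm
    (seqSpace_subset_of_le (inv_pos.mpr hc) fun _ => (div_eq_inv_mul _ _).le)
    (seqSpace_subset_of_le hc fun _ => (mul_div_cancel₀ _ hc.ne').ge)

theorem div_zero_mem_bangFamily {L : ℕ → ℝ} (hpos : ∀ k, 0 < L k) (hq : ¬ IsQuasianalytic L)
    (hL : IsWeaklyLogConvex L) : (fun k => L k / L 0) ∈ bangFamily := by
  have h0 := hpos 0
  refine ⟨fun k => div_pos (hpos k) h0, fun h => hq (h.of_le h0 fun k =>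
    (mul_div_cancel₀ _ h0.ne').ge), ?_⟩
  refine IsLogConvex.monotoneOn_root (m := fun k => (k ! : ℝ) * (L k / L 0)) (fun k => ?_)
    (fun k => ?_) (by simp [h0.ne'])
  · have := hL k
    simp only at this ⊢
    calc _ = (((k + 1)! : ℝ) * L (k + 1)) ^ 2 / L 0 ^ 2 := by ring
      _ ≤ ((k ! : ℝ) * L k * (((k + 2)! : ℝ) * L (k + 2))) / L 0 ^ 2 := by gcongr
      _ = _ := by ring
  · have := hpos k; positivity

/-- A non-quasianalytic sequence is eventually at least `1`, as otherwise `L k ≤ 1` for infinitely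
many `k`. -/
theorem seqSpace_omega_subset {L : ℕ → ℝ} (hpos : ∀ k, 0 < L k) (hq : ¬ IsQuasianalytic L) :
    seqSpace omega ⊆ seqSpace L := by
  have hev : ∀ᶠ k in atTop, 1 ≤ L k := by
    by_contra hcon
    refine hq (isQuasianalytic_of_frequently_le zero_le_one
      ((not_eventually.mp hcon).mono fun k hk => ?_))
    rw [one_pow]; exact (not_le.mp hk).le
  obtain ⟨N, hN⟩ := eventually_atTop.mp hev
  have hS : 0 ≤ ∑ k ∈ Finset.range N, (L k)⁻¹ :=
    Finset.sum_nonneg fun k _ => (inv_pos.mpr (hpos k)).le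
  refine seqSpace_subset_of_le (c := 1 + ∑ k ∈ Finset.range N, (L k)⁻¹) (by linarith) fun k => ?_
  rw [omega, ← div_le_iff₀ (hpos k), one_div]
  rcases lt_or_ge k N with hk | hk
  · have := Finset.single_le_sum (fun i (_ : i ∈ Finset.range N) => (inv_pos.mpr (hpos i)).le)
      (Finset.mem_range.mpr hk)
    linarith
  · have := inv_le_one_of_one_le₀ (hN k hk)
    linarith

end DenjoyCarleman

end

theorem corollary1p7 :
    (∀ Q : ℕ → ℝ, DenjoyCarleman.IsWeightSequence Q → DenjoyCarleman.IsQuasianalytic Q →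
      DenjoyCarleman.seqSpace Q =
        ⋂ L ∈ DenjoyCarleman.weakMajorants Q, DenjoyCarleman.seqSpace L) ∧
    (DenjoyCarleman.IsWeightSequence DenjoyCarleman.omega ∧
      DenjoyCarleman.IsQuasianalytic DenjoyCarleman.omega ∧
      DenjoyCarleman.seqSpace DenjoyCarleman.omega =
        ⋂ L ∈ DenjoyCarleman.weakMajorants DenjoyCarleman.omega, DenjoyCarleman.seqSpace L) ∧
    ((∀ L ∈ DenjoyCarleman.weakMajorants DenjoyCarleman.omega,
        (fun k => L k / L 0) ∈ DenjoyCarleman.bangFamily ∧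
          DenjoyCarleman.seqSpace (fun k => L k / L 0) = DenjoyCarleman.seqSpace L) ∧
      DenjoyCarleman.seqSpace DenjoyCarleman.omega =
        ⋂ L ∈ DenjoyCarleman.bangFamily, DenjoyCarleman.seqSpace L) := by
  have homega :=
    DenjoyCarleman.seqSpace_eq_iInter_weakMajorants DenjoyCarleman.isWeightSequence_omega
  have hbang : ∀ L ∈ DenjoyCarleman.weakMajorants DenjoyCarleman.omega,
      (fun k => L k / L 0) ∈ DenjoyCarleman.bangFamily ∧
        DenjoyCarleman.seqSpace (fun k => L k / L 0) = DenjoyCarleman.seqSpace L := fun L hL =>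
    ⟨DenjoyCarleman.div_zero_mem_bangFamily hL.1 hL.2.2.1 hL.2.2.2,
      DenjoyCarleman.seqSpace_div (hL.1 0)⟩
  refine ⟨fun Q hQ _ => DenjoyCarleman.seqSpace_eq_iInter_weakMajorants hQ,
    ⟨DenjoyCarleman.isWeightSequence_omega, DenjoyCarleman.isQuasianalytic_omega, homega⟩, hbang,
    Set.Subset.antisymm ?_ ?_⟩
  · exact Set.subset_iInter₂ fun L hL => DenjoyCarleman.seqSpace_omega_subset hL.1 hL.2.1
  · rw [homega]
    refine Set.subset_iInter₂ fun L hL => ?_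
    rw [← (hbang L hL).2]
    exact Set.biInter_subset_of_mem (hbang L hL).1
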